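/- Let $(\alpha_n)_{n\ge0}$ be the integer sequence of pseudo-factorials, defined by $\alpha_0=1$ and $\alpha_{n+1}=(-1)^{n+1}\sum_{k=0}^{n}\binom nk\alpha_k\alpha_{n-k}$ for $n\ge0$. For $j\ge 0$ put $c_j=(-1)^{j-1}\bigl(j+\tfrac{1+(-1)^j}{2}\bigr)$ and $a_j=-j^2\bigl(2-(-1)^j\bigr)$, and let $Q_m(z)\in\mathbb Z[z]$ be the denominators of the convergents of the continued fraction $$\cfrac{1}{1-c_0z-\cfrac{a_1z^2}{1-c_1z-\cfrac{a_2z^2}{\ddots}}},$$ that is, $Q_0=1$, $Q_1=1-c_0z$ and $Q_k=(1-c_{k-1}z)Q_{k-1}-a_{k-1}z^2Q_{k-2}$ for $k\ge2$. (i) For every integer $M\ge2$ the sequence $(\alpha_n \bmod M)$ is eventually periodic. (ii) For each $m\ge2$ the polynomial $Q_m$ has constant term $1$ and degree at most $m$, and modulo $M=3^{\lceil m/2\rceil}\,m!^2$ the sequence $(\alpha_n)$ satisfies a linear recurrence with constant coefficients of order at most $m$ with characteristic polynomial given by $Q_m$: writing $Q_m(z)=1+\sum_{i=1}^m b_i z^i$,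 one has $\alpha_{n+m}\equiv-\sum_{i=1}^m b_i\,\alpha_{n+m-i}\pmod M$ for all $n\ge0$; equivalently, the characteristic polynomial of the recurrence, in the usual normalization, is the reciprocal polynomial $z^mQ_m(1/z)$ reduced modulo $M$. -/

import Mathlib

open Polynomial
open scoped Nat

/-- The pseudo-factorials `α₀ = 1`, `αₙ₊₁ = (-1)ⁿ⁺¹ ∑_{k=0}^{n} (n choose k) αₖ αₙ₋ₖ`.
The sum over `k ∈ {0, …, n}` is indexed by `Fin (n + 1)`. -/
def pseudoFactorial : ℕ → ℤ
  | 0 => 1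
  | n + 1 => (-1) ^ (n + 1) *
      ∑ k : Fin (n + 1), (n.choose k : ℤ) * pseudoFactorial k * pseudoFactorial (n - k)

/-- The coefficients `c_j = (-1)^(j-1) (j + (1 + (-1)^j) / 2)` (the division is exact), that is
`-1, 1, -3, 3, -5, 5, …`, of the Jacobi continued fraction
`1 / (1 - c₀ z - a₁ z² / (1 - c₁ z - a₂ z² / ⋯))`. -/
def jacobiC (j : ℕ) : ℤ := (-1) ^ (j + 1) * (j + (1 + (-1) ^ j) / 2)

/-- The coefficients `a_j = -j² (2 - (-1)^j)`, that is `-3·1², -2², -3·3², -4², …` for `j ≥ 1`,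
of the same continued fraction. -/
def jacobiA (j : ℕ) : ℤ := -(j : ℤ) ^ 2 * (2 - (-1) ^ j)

/-- The denominators `Q_m(z)` of the convergents of the Jacobi continued fraction with
coefficients `c_j`, `a_j`:
`Q₀ = 1`, `Q₁ = 1 - c₀ z`, `Q_k = (1 - c_{k-1} z) Q_{k-1} - a_{k-1} z² Q_{k-2}`. -/
noncomputable def convergentDenom : ℕ → ℤ[X]
  | 0 => 1
  | 1 => 1 - C (jacobiC 0) * X
  | k + 2 => (1 - C (jacobiC (k + 1)) * X) * convergentDenom (k + 1)
      - C (jacobiA (k + 1)) * X ^ 2 * convergentDenom k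

/-! Write `A` for the exponential generating function of the sequence and `B(z) = A(-z)`. The
recurrence says `A' = -B²`, `B' = A²`, so `A³ + B³ = 2`. With `g = (1 - AB)/6`, suitable multiples
of `A gᵏ` and `(B² - A) gᵏ` satisfy the tridiagonal differential system with coefficients `c_j`,
`a_j`, which is the recursion of the columns of `jacobiPath`; hence `pseudoFactorial n = jacobiPath
n 0` (`coeff_columns`). The reciprocal of `Q_m`, evaluated at the shift, sends column `0` to `a₁ ⋯
a_m` times column `m` (`aeval_seqShift_reflect_convergentDenom`). As `a₁ ⋯ a_m = ± 3^⌈m/2⌉ m!²`,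
this is the recurrence modulo that number. Periodicity modulo `M` follows with `m = M`, since `M ∣
M!`. -/

/-- The weighted Motzkin path counts of the Jacobi continued fraction: `jacobiPath n k` is the total
weight of the paths of length `n` from height `k` to height `0`. -/
def jacobiPath : ℕ → ℕ → ℤ
  | 0, 0 => 1
  | 0, _ + 1 => 0
  | n + 1, 0 => jacobiC 0 * jacobiPath n 0 + jacobiA 1 * jacobiPath n 1
  | n + 1, k + 1 => jacobiPath n k + jacobiC (k + 1) * jacobiPath n (k + 1) +
      jacobiA (k + 2) * jacobiPath n (k + 2)

theorem jacobiC_even (k : ℕ) : jacobiC (2 * k) = -(2 * k + 1) := by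
  simp [jacobiC, pow_succ]

theorem jacobiC_odd (k : ℕ) : jacobiC (2 * k + 1) = 2 * k + 1 := by
  simp [jacobiC, pow_succ]

theorem jacobiA_even (k : ℕ) : jacobiA (2 * k) = -(2 * k) ^ 2 := by
  simp [jacobiA]

theorem jacobiA_odd (k : ℕ) : jacobiA (2 * k + 1) = -3 * (2 * k + 1) ^ 2 := by
  simp [jacobiA, pow_succ]
  ring

/-! ### Generating functions and the Fermat cubic -/

namespace PowerSeries

/-- The exponential generating function `A(z)` of the pseudo-factorials. -/
noncomputable def pseudoExp : ℚ⟦X⟧ := PowerSeries.mk fun n => (pseudoFactorial n : ℚ) / n !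

/-- The series `A(-z)`. -/
noncomputable def pseudoExpNeg : ℚ⟦X⟧ :=
  PowerSeries.mk fun n => (-1) ^ n * (pseudoFactorial n : ℚ) / n !

theorem pseudoFactorial_succ (n : ℕ) : pseudoFactorial (n + 1) = (-1) ^ (n + 1) *
    ∑ p ∈ Finset.HasAntidiagonal.antidiagonal n,
      (n.choose p.1 : ℤ) * pseudoFactorial p.1 * pseudoFactorial p.2 := by
  rw [pseudoFactorial, Finset.Nat.sum_antidiagonal_eq_sum_range_succ
    (fun i j => (n.choose i : ℤ) * pseudoFactorial i * pseudoFactorial j),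
    Finset.sum_range]

theorem coeff_pseudoExp_sq (n : ℕ) : coeff n (pseudoExp ^ 2) =
    (-1) ^ (n + 1) * (pseudoFactorial (n + 1) : ℚ) / n ! := by
  rw [pseudoFactorial_succ, sq, coeff_mul]
  push_cast
  rw [← mul_assoc, ← pow_add, Even.neg_one_pow ⟨n + 1, rfl⟩, one_mul, Finset.sum_div]
  refine Finset.sum_congr rfl fun p hp => ?_
  obtain rfl := Finset.HasAntidiagonal.mem_antidiagonal.1 hp
  rw [Nat.cast_add_choose]
  simp only [pseudoExp, coeff_mk]
  have := Nat.factorial_ne_zero (p.1 + p.2)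
  field_simp

theorem coeff_pseudoExpNeg_sq (n : ℕ) : coeff n (pseudoExpNeg ^ 2) =
    -(pseudoFactorial (n + 1) : ℚ) / n ! := by
  have h : coeff n (pseudoExpNeg ^ 2) = (-1) ^ n * coeff n (pseudoExp ^ 2) := by
    rw [sq, sq, coeff_mul, coeff_mul, Finset.mul_sum]
    refine Finset.sum_congr rfl fun p hp => ?_
    obtain rfl := Finset.HasAntidiagonal.mem_antidiagonal.1 hp
    simp only [pseudoExp, pseudoExpNeg, coeff_mk, pow_add]
    ring
  rw [h, coeff_pseudoExp_sq, mul_div_assoc, ← mul_assoc, ← pow_add,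
    Odd.neg_one_pow ⟨n, by ring⟩]
  ring

/-- Replacing `z` by `-z` in `A²` cancels the alternating sign of the recurrence; this is what
couples `A` to `A(-z)`. -/
theorem derivative_pseudoExp : d⁄dX ℚ pseudoExp = -pseudoExpNeg ^ 2 := by
  ext n
  rw [coeff_derivative, map_neg, coeff_pseudoExpNeg_sq, pseudoExp, coeff_mk, Nat.factorial_succ]
  push_cast
  field_simp

theorem derivative_pseudoExpNeg : d⁄dX ℚ pseudoExpNeg = pseudoExp ^ 2 := by
  ext n
  rw [coeff_derivative, coeff_pseudoExp_sq, pseudoExpNeg, coeff_mk, Nat.factorial_succ]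
  push_cast
  field_simp

theorem constantCoeff_pseudoExp : constantCoeff pseudoExp = 1 := by
  rw [← coeff_zero_eq_constantCoeff_apply, pseudoExp, coeff_mk]
  simp [pseudoFactorial]

theorem constantCoeff_pseudoExpNeg : constantCoeff pseudoExpNeg = 1 := by
  rw [← coeff_zero_eq_constantCoeff_apply, pseudoExpNeg, coeff_mk]
  simp [pseudoFactorial]

/-- The generating functions `A(z)` and `A(-z)` parametrize the Fermat cubic. -/
theorem pseudoExp_cube_add : pseudoExp ^ 3 + pseudoExpNeg ^ 3 = 2 := by
  refine derivative.ext ?_ ?_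
  · rw [map_add, derivative_pow, derivative_pow, derivative_pseudoExp, derivative_pseudoExpNeg,
      ← map_ofNat C 2, derivative_C]
    push_cast
    ring
  · simp only [map_add, map_pow, constantCoeff_pseudoExp, constantCoeff_pseudoExpNeg]
    rw [← map_ofNat C 2, constantCoeff_C]
    norm_num

/-- The series `(1 - A(z) A(-z)) / 6`. -/
noncomputable def pseudoGap : ℚ⟦X⟧ := C (1 / 6) * (1 - pseudoExp * pseudoExpNeg)

theorem six_mul_pseudoGap : 6 * pseudoGap = 1 - pseudoExp * pseudoExpNeg := by
  rw [pseudoGap, ← mul_assoc, ← map_ofNat C 6, ← map_mul]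
  norm_num

theorem six_mul_derivative_pseudoGap :
    6 * d⁄dX ℚ pseudoGap = pseudoExpNeg ^ 3 - pseudoExp ^ 3 := by
  have h := congrArg (d⁄dX ℚ) six_mul_pseudoGap
  rw [← map_ofNat C 6, Derivation.leibniz, derivative_C, map_sub,
    derivative_one, Derivation.leibniz, derivative_pseudoExp, derivative_pseudoExpNeg] at h
  simp only [smul_eq_mul, mul_zero, add_zero] at h
  rw [← map_ofNat C 6, h]
  ring

theorem constantCoeff_pseudoGap : constantCoeff pseudoGap = 0 := by
  simp [pseudoGap, constantCoeff_pseudoExp, constantCoeff_pseudoExpNeg]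

/-! ### Columns of the path array and their differential system -/

/-- The leading scalars of the columns of even index. -/
def evenScalar : ℕ → ℚ
  | 0 => 1
  | k + 1 => evenScalar k / ((2 * k + 1) * (k + 1))

/-- The exponential generating function of the column `2 k` of `jacobiPath`. -/
noncomputable def evenColumn (k : ℕ) : ℚ⟦X⟧ := C (evenScalar k) * (pseudoExp * pseudoGap ^ k)

/-- The exponential generating function of the column `2 k + 1` of `jacobiPath`. -/
noncomputable def oddColumn (k : ℕ) : ℚ⟦X⟧ :=
  C (evenScalar k / (3 * (2 * k + 1))) * ((pseudoExpNeg ^ 2 - pseudoExp) * pseudoGap ^ k)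

/-- Eliminates `g'` from the derivative of `A gᵏ`, by reduction modulo the cubic. -/
theorem pseudoExp_mul_derivative_pseudoGap : pseudoExp * d⁄dX ℚ pseudoGap * 3 =
    pseudoExpNeg ^ 2 - pseudoExp - 6 * pseudoGap * pseudoExpNeg ^ 2 := by
  have := algebraRat.charZero ℚ⟦X⟧
  have h : (2 : ℚ⟦X⟧) ≠ 0 := by norm_num
  refine mul_left_cancel₀ h ?_
  linear_combination pseudoExp * six_mul_derivative_pseudoGap - pseudoExp * pseudoExp_cube_add
    - (-2 * pseudoExpNeg ^ 2) * six_mul_pseudoGap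

/-- The counterpart for `(B² - A) gᵏ`; the factor `g` on the right restores the power lost in
differentiating `gᵏ`. -/
theorem sub_mul_derivative_pseudoGap : (pseudoExpNeg ^ 2 - pseudoExp) * d⁄dX ℚ pseudoGap =
    2 * pseudoGap * (pseudoExpNeg ^ 2 + 2 * pseudoExp - 6 * pseudoExp * pseudoGap) := by
  have := algebraRat.charZero ℚ⟦X⟧
  have h : (6 : ℚ⟦X⟧) ≠ 0 := by norm_num
  refine mul_left_cancel₀ h ?_
  have h1 := six_mul_derivative_pseudoGap
  have h2 := six_mul_pseudoGap
  have h3 := pseudoExp_cube_add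
  generalize d⁄dX ℚ pseudoGap = D at *
  generalize pseudoGap = g at *
  generalize pseudoExp = A at *
  generalize pseudoExpNeg = B at *
  have e : 12 * g * (B ^ 2 + 2 * A - 6 * A * g) =
      2 * (1 - A * B) * (B ^ 2 + 2 * A - A * (1 - A * B)) := by
    rw [← h2]; ring
  linear_combination (B ^ 2 - A) * h1 - e + (B ^ 2 + A) * h3

theorem derivative_evenColumn_zero :
    d⁄dX ℚ (evenColumn 0) = -evenColumn 0 - 3 * oddColumn 0 := by
  have h : (3 : ℚ⟦X⟧) * C (1 / 3) = 1 := by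
    rw [← map_ofNat C 3, ← map_mul]; norm_num
  simp only [evenColumn, oddColumn, evenScalar, pow_zero, mul_one, map_one, one_mul,
    derivative_pseudoExp, Nat.cast_zero, mul_zero, zero_add]
  linear_combination (pseudoExpNeg ^ 2 - pseudoExp) * h

/-- The coefficients are `1`, `c_{2k+2}` and `a_{2k+3}`: differentiation shifts an exponential
generating function, so this is the path recursion at height `2k + 2`. -/
theorem derivative_evenColumn_succ (k : ℕ) : d⁄dX ℚ (evenColumn (k + 1)) =
    oddColumn k - (2 * k + 3) * evenColumn (k + 1)
      - 3 * (2 * k + 3) ^ 2 * oddColumn (k + 1) := by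
  have h1 : 3 * (2 * k + 3) * C (evenScalar (k + 1) / (3 * (2 * (k + 1 : ℕ) + 1))) =
      (C (evenScalar (k + 1)) : ℚ⟦X⟧) := by
    rw [show (3 * (2 * k + 3) : ℚ⟦X⟧) = C (3 * (2 * k + 3) : ℚ) by
      simp only [map_add, map_mul, map_ofNat, map_natCast], ← map_mul]
    congr 1
    push_cast
    field_simp
    ring
  have h2 : 3 * C (evenScalar k / (3 * (2 * k + 1))) =
      ((k + 1) * C (evenScalar (k + 1)) : ℚ⟦X⟧) := by
    rw [show (k + 1 : ℚ⟦X⟧) = C (k + 1 : ℚ) by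
      simp only [map_add, map_natCast, map_one], ← map_ofNat C 3,
      ← map_mul, ← map_mul]
    congr 1
    rw [evenScalar]
    field_simp
  have h3 := pseudoExp_mul_derivative_pseudoGap
  simp only [evenColumn, oddColumn, Derivation.leibniz, derivative_C, derivative_pow,
    derivative_pseudoExp, smul_eq_mul, Nat.add_sub_cancel]
  generalize C (evenScalar (k + 1) / (3 * (2 * (k + 1 : ℕ) + 1))) = V' at *
  generalize C (evenScalar k / (3 * (2 * k + 1))) = V at *
  generalize C (evenScalar (k + 1)) = U at *
  generalize d⁄dX ℚ pseudoGap = D at *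
  generalize pseudoGap = g at *
  generalize pseudoExp = A at *
  generalize pseudoExpNeg = B at *
  have := algebraRat.charZero ℚ⟦X⟧
  have h : (3 : ℚ⟦X⟧) ≠ 0 := by norm_num
  refine mul_left_cancel₀ h ?_
  push_cast
  rw [pow_succ]
  generalize g ^ k = G at *
  linear_combination U * (k + 1) * G * h3 - (B ^ 2 - A) * G * h2 +
    3 * (2 * k + 3) * (B ^ 2 - A) * G * g * h1

theorem derivative_oddColumn (k : ℕ) : d⁄dX ℚ (oddColumn k) =
    evenColumn k + (2 * k + 1) * oddColumn k
      - (2 * k + 2) ^ 2 * evenColumn (k + 1) := by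
  have h1 : 3 * (2 * k + 1) * C (evenScalar k / (3 * (2 * k + 1))) =
      (C (evenScalar k) : ℚ⟦X⟧) := by
    rw [show (3 * (2 * k + 1) : ℚ⟦X⟧) = C (3 * (2 * k + 1) : ℚ) by
      simp only [map_add, map_mul, map_ofNat, map_natCast, map_one], ← map_mul]
    congr 1
    field_simp
  have h2 : 3 * C (evenScalar k / (3 * (2 * k + 1))) =
      ((k + 1) * C (evenScalar (k + 1)) : ℚ⟦X⟧) := by
    rw [show (k + 1 : ℚ⟦X⟧) = C (k + 1 : ℚ) by
      simp only [map_add, map_natCast, map_one], ← map_ofNat C 3,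
      ← map_mul, ← map_mul]
    congr 1
    rw [evenScalar]
    field_simp
  -- At `k = 0` the exponent `k - 1` is truncated, but the factor `k` kills the term.
  have h3 : (pseudoExpNeg ^ 2 - pseudoExp) * (k * pseudoGap ^ (k - 1) * d⁄dX ℚ pseudoGap) =
      2 * k * pseudoGap ^ k *
        (pseudoExpNeg ^ 2 + 2 * pseudoExp - 6 * pseudoExp * pseudoGap) := by
    cases k with
    | zero => simp
    | succ k =>
      rw [Nat.add_sub_cancel, pow_succ]
      linear_combination ((k + 1 : ℕ) : ℚ⟦X⟧) * pseudoGap ^ k * sub_mul_derivative_pseudoGap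
  have h4 := six_mul_pseudoGap
  simp only [evenColumn, oddColumn, Derivation.leibniz, derivative_C, derivative_pow, map_sub,
    derivative_pseudoExp, derivative_pseudoExpNeg, smul_eq_mul]
  generalize (k * pseudoGap ^ (k - 1) * d⁄dX ℚ pseudoGap : ℚ⟦X⟧) = D at *
  rw [pow_succ pseudoGap]
  generalize C (evenScalar k / (3 * (2 * k + 1))) = V at *
  generalize C (evenScalar (k + 1)) = U' at *
  generalize C (evenScalar k) = U at *
  generalize pseudoGap ^ k = G at *
  generalize pseudoGap = g at *
  generalize pseudoExp = A at *
  generalize pseudoExpNeg = B at *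
  push_cast
  linear_combination V * h3 + 2 * A * G * V * h4 + A * G * h1 - 4 * (k + 1) * A * G * g * h2

/-- The step at one height uses its neighbours, so the induction on `n` treats all heights together.
At `n = 0` only column `0` has a nonzero constant term. -/
theorem coeff_columns (n : ℕ) : ∀ k : ℕ,
    (n ! : ℚ) * coeff n (evenColumn k) = jacobiPath n (2 * k) ∧
      (n ! : ℚ) * coeff n (oddColumn k) = jacobiPath n (2 * k + 1) := by
  induction n with
  | zero =>
    intro k
    constructor
    · cases k <;> simp [evenColumn, jacobiPath, evenScalar, constantCoeff_pseudoExp,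
        constantCoeff_pseudoGap, Nat.mul_succ]
    · simp [oddColumn, jacobiPath, constantCoeff_pseudoExp, constantCoeff_pseudoExpNeg]
  | succ n ih =>
    have hd : ∀ f : ℚ⟦X⟧, ((n + 1)! : ℚ) * coeff (n + 1) f =
        n ! * coeff n (d⁄dX ℚ f) := fun f => by
      rw [coeff_derivative, Nat.factorial_succ]
      push_cast
      ring
    have hC : ∀ (q : ℚ) (f : ℚ⟦X⟧), coeff n (C q * f) = q * coeff n f := fun q f =>
      coeff_C_mul n f q
    intro k
    rw [hd, hd]
    constructor
    · cases k with
      | zero =>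
        have hs := derivative_evenColumn_zero
        rw [← map_ofNat C 3] at hs
        rw [hs, map_sub, map_neg, hC, mul_zero, jacobiPath]
        have := jacobiC_even 0
        have := jacobiA_odd 0
        have h1 := (ih 0).1
        have h2 := (ih 0).2
        simp only [mul_zero, zero_add] at *
        simp only [*]
        push_cast
        linear_combination -h1 - 3 * h2
      | succ k =>
        have hs := derivative_evenColumn_succ k
        rw [show (2 * k + 3 : ℚ⟦X⟧) = C (2 * k + 3 : ℚ) by
      simp only [map_add, map_mul, map_ofNat, map_natCast],
          ← map_ofNat C 3, ← map_pow, ← map_mul] at hs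
        rw [hs, map_sub, map_sub, hC, hC, show 2 * (k + 1) = 2 * k + 1 + 1 by ring, jacobiPath,
          show 2 * k + 1 + 1 = 2 * (k + 1) by ring, show 2 * k + 1 + 2 = 2 * (k + 1) + 1 by ring,
          jacobiC_even, jacobiA_odd]
        push_cast
        linear_combination (ih k).2 - (2 * k + 3) * (ih (k + 1)).1
          - 3 * (2 * k + 3) ^ 2 * (ih (k + 1)).2
    · have hs := derivative_oddColumn k
      rw [show (2 * k + 1 : ℚ⟦X⟧) = C (2 * k + 1 : ℚ) by
      simp only [map_add, map_mul, map_ofNat, map_natCast, map_one],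
        show (2 * k + 2 : ℚ⟦X⟧) = C (2 * k + 2 : ℚ) by
      simp only [map_add, map_mul, map_ofNat, map_natCast], ← map_pow] at hs
      rw [hs, map_sub, map_add, hC, hC, jacobiPath, jacobiC_odd,
        show 2 * k + 2 = 2 * (k + 1) by ring, jacobiA_even]
      push_cast
      linear_combination (ih k).1 + (2 * k + 1) * (ih k).2 - (2 * k + 2) ^ 2 * (ih (k + 1)).1

/-- The Jacobi continued fraction expansion of the pseudo-factorials, as a count of paths. -/
theorem _root_.pseudoFactorial_eq_jacobiPath (n : ℕ) : pseudoFactorial n = jacobiPath n 0 := by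
  have h := (coeff_columns n 0).1
  simp only [evenColumn, evenScalar, map_one, pow_zero, mul_one, one_mul, mul_zero, pseudoExp,
    coeff_mk] at h
  have := Nat.factorial_ne_zero n
  field_simp at h
  exact_mod_cast h

end PowerSeries

/-! ### Convergent denominators acting by the shift -/

/-- The shift operator on integer sequences. -/
def seqShift : Module.End ℤ (ℕ → ℤ) where
  toFun u n := u (n + 1)
  map_add' _ _ := rfl
  map_smul' _ _ := rfl

theorem seqShift_pow_apply (i : ℕ) (u : ℕ → ℤ) (n : ℕ) : (seqShift ^ i) u n = u (n + i) := by
  induction i generalizing u n with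
  | zero => rfl
  | succ i ih => rw [pow_succ, Module.End.mul_apply, ih]; rfl

theorem aeval_seqShift_apply {q : ℤ[X]} {m : ℕ} (hq : q.natDegree ≤ m) (u : ℕ → ℤ) (n : ℕ) :
    aeval seqShift q u n = ∑ i ∈ Finset.range (m + 1), q.coeff i * u (n + i) := by
  rw [aeval_eq_sum_range' (Nat.lt_succ_of_le hq)]
  simp [seqShift_pow_apply]

theorem natDegree_convergentDenom_le (m : ℕ) : (convergentDenom m).natDegree ≤ m := by
  induction m using Nat.twoStepInduction with
  | zero => simp [convergentDenom]
  | one =>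
    rw [convergentDenom]
    compute_degree
  | more m h0 h1 =>
    rw [convergentDenom]
    refine (natDegree_sub_le _ _).trans (max_le ?_ ?_)
    · refine (natDegree_mul_le_of_le (m := 1) ?_ h1).trans (by omega)
      compute_degree
    · refine (natDegree_mul_le_of_le (m := 2) ?_ h0).trans (by omega)
      compute_degree

theorem coeff_zero_convergentDenom (m : ℕ) : (convergentDenom m).coeff 0 = 1 := by
  induction m using Nat.twoStepInduction with
  | zero => simp [convergentDenom]
  | one => simp [convergentDenom]
  | more m h0 h1 => simp [convergentDenom, mul_coeff_zero, h1]

theorem reflect_one_sub_C_mul_X (c : ℤ) : (1 - C c * X : ℤ[X]).reflect 1 = X - C c := by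
  rw [reflect_sub, reflect_one, reflect_C_mul, reflect_one_X, pow_one, mul_one]

/-- Reversal yields the monic three-term recurrence of the orthogonal polynomials attached to the
continued fraction. -/
theorem reflect_convergentDenom_add_two (k : ℕ) :
    (convergentDenom (k + 2)).reflect (k + 2) =
      (X - C (jacobiC (k + 1))) * (convergentDenom (k + 1)).reflect (k + 1)
        - C (jacobiA (k + 1)) * (convergentDenom k).reflect k := by
  have h1 : (1 - C (jacobiC (k + 1)) * X : ℤ[X]).natDegree ≤ 1 := by compute_degree
  have h2 : (X ^ 2 : ℤ[X]).natDegree ≤ 2 := by compute_degree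
  have e1 := reflect_mul _ _ h1 (natDegree_convergentDenom_le (k + 1))
  have e2 := reflect_mul _ _ h2 (natDegree_convergentDenom_le k)
  rw [show 1 + (k + 1) = k + 2 by ring] at e1
  rw [show 2 + k = k + 2 by ring] at e2
  rw [convergentDenom, reflect_sub, e1, mul_assoc, reflect_C_mul, e2, reflect_one_sub_C_mul_X,
    reflect_monomial]
  simp

/-- The path recursion expresses the shift of column `m + 1` through columns `m`, `m + 1`, `m + 2`;
the three-term recurrence cancels the first two. -/
theorem aeval_seqShift_reflect_convergentDenom (m n : ℕ) :
    aeval seqShift ((convergentDenom m).reflect m) pseudoFactorial n =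
      (∏ j ∈ Finset.range m, jacobiA (j + 1)) * jacobiPath n m := by
  induction m using Nat.twoStepInduction generalizing n with
  | zero => simp [convergentDenom, pseudoFactorial_eq_jacobiPath]
  | one =>
    rw [convergentDenom, reflect_one_sub_C_mul_X]
    simp only [map_sub, aeval_X, aeval_C, LinearMap.sub_apply, Module.algebraMap_end_apply,
      Pi.sub_apply, Pi.smul_apply, smul_eq_mul]
    change pseudoFactorial (n + 1) - _ = _
    rw [pseudoFactorial_eq_jacobiPath, pseudoFactorial_eq_jacobiPath, jacobiPath]
    simp
  | more m h0 h1 =>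
    rw [reflect_convergentDenom_add_two]
    simp only [map_sub, map_mul, aeval_X, aeval_C, sub_mul, LinearMap.sub_apply,
      Module.End.mul_apply, Module.algebraMap_end_apply, Pi.sub_apply, Pi.smul_apply, smul_eq_mul]
    change aeval seqShift ((convergentDenom (m + 1)).reflect (m + 1)) pseudoFactorial (n + 1)
      - _ - _ = _
    rw [h0, h1, h1, Finset.prod_range_succ _ (m + 1), Finset.prod_range_succ _ m, jacobiPath]
    ring

/-- Each odd index up to `m` contributes one factor `3`, and there are `(m + 1) / 2` of them. -/
theorem prod_jacobiA (m : ℕ) : ∏ j ∈ Finset.range m, jacobiA (j + 1) =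
    (3 ^ ((m + 1) / 2) * m ! ^ 2 : ℕ) * (-1) ^ m := by
  induction m with
  | zero => simp
  | succ m ih =>
    rw [Finset.prod_range_succ, Nat.factorial_succ, ih]
    obtain ⟨k, rfl | rfl⟩ := m.even_or_odd'
    · rw [jacobiA_odd, show (2 * k + 1 + 1) / 2 = (2 * k + 1) / 2 + 1 by omega]
      push_cast
      ring
    · rw [show 2 * k + 1 + 1 = 2 * (k + 1) by ring, jacobiA_even,
        show (2 * (k + 1) + 1) / 2 = 2 * (k + 1) / 2 by omega]
      push_cast
      ring

theorem natCeil_half (m : ℕ) : ⌈(m : ℚ) / 2⌉₊ = (m + 1) / 2 := by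
  refine eq_of_forall_ge_iff fun c => ?_
  rw [Nat.ceil_le, div_le_iff₀ two_pos]
  norm_cast
  omega

/-! ### Linear recurrences over finite rings and the conclusion -/

/-- The linear recurrence with a given monic characteristic polynomial. -/
theorem exists_linearRecurrence_charPoly_eq {R : Type*} [CommRing R] {q : R[X]} {m : ℕ}
    (hq : q.natDegree ≤ m) (hm : q.coeff m = 1) :
    ∃ E : LinearRecurrence R, E.order = m ∧ E.charPoly = q ∧
      ∀ u : ℕ → R, (∀ n, ∑ i ∈ Finset.range (m + 1), q.coeff i * u (n + i) = 0) →
        E.IsSolution u := by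
  refine ⟨⟨m, fun i => -q.coeff i⟩, rfl, ?_, fun u hu n => ?_⟩
  · rw [LinearRecurrence.charPoly]
    simp only [map_neg, Finset.sum_neg_distrib, sub_neg_eq_add]
    conv_rhs => rw [q.as_sum_range' (m + 1) (Nat.lt_succ_of_le hq), Finset.sum_range_succ, hm,
      Finset.sum_range, add_comm]
  · have h := hu n
    rw [Finset.sum_range_succ, hm, one_mul, Finset.sum_range] at h
    simp only [neg_mul, Finset.sum_neg_distrib]
    linear_combination h

/-- A solution of a linear recurrence over a finite ring is eventually periodic. -/
theorem LinearRecurrence.IsSolution.eventually_periodic {R : Type*} [CommRing R] [Finite R]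
    {E : LinearRecurrence R} {u : ℕ → R} (hu : E.IsSolution u) :
    ∃ p : ℕ, 0 < p ∧ ∃ N : ℕ, ∀ n : ℕ, N ≤ n → u (n + p) = u n := by
  -- Pigeonhole on windows of length `E.order`: a repeated window determines everything after it.
  obtain ⟨a, b, hab, h⟩ := Finite.exists_ne_map_eq_of_infinite
    fun n : ℕ => fun i : Fin E.order => u (n + i)
  wlog hlt : a < b generalizing a b
  · exact this b a hab.symm h.symm (by omega)
  have hs : ∀ c, E.IsSolution fun n => u (c + n) := fun c n => by
    simpa only [add_assoc] using hu (c + n)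
  have key : (fun n => u (a + n)) = fun n => u (b + n) :=
    (E.eq_iff_eqOn_range_order _ _ (hs a) (hs b)).2 fun i hi =>
      congrFun h ⟨i, by simpa using hi⟩
  refine ⟨b - a, by omega, a, fun n hn => ?_⟩
  have : u (a + (n - a)) = u (b + (n - a)) := congrFun key (n - a)
  rw [show a + (n - a) = n by omega, show b + (n - a) = n + (b - a) by omega] at this
  exact this.symm

theorem exists_linearRecurrence_pseudoFactorial (m : ℕ) :
    ∃ E : LinearRecurrence (ZMod (3 ^ ⌈(m : ℚ) / 2⌉₊ * m ! ^ 2)),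
      E.order = m ∧
      E.charPoly = ((convergentDenom m).reflect m).map
        (Int.castRingHom (ZMod (3 ^ ⌈(m : ℚ) / 2⌉₊ * m ! ^ 2))) ∧
      E.IsSolution (fun n => (pseudoFactorial n :
        ZMod (3 ^ ⌈(m : ℚ) / 2⌉₊ * m ! ^ 2))) := by
  have hdeg : ((convergentDenom m).reflect m).natDegree ≤ m :=
    natDegree_le_iff_coeff_eq_zero.2 fun i hi => by
      rw [coeff_reflect, revAt_eq_self_of_lt hi]
      exact coeff_eq_zero_of_natDegree_lt ((natDegree_convergentDenom_le m).trans_lt hi)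
  have hlead : ((convergentDenom m).reflect m).coeff m = 1 := by
    rw [coeff_reflect, revAt_le le_rfl, Nat.sub_self, coeff_zero_convergentDenom]
  obtain ⟨E, h1, h2, h3⟩ := exists_linearRecurrence_charPoly_eq
    (q := ((convergentDenom m).reflect m).map
      (Int.castRingHom (ZMod (3 ^ ⌈(m : ℚ) / 2⌉₊ * m ! ^ 2))))
    (natDegree_map_le.trans hdeg) (by rw [coeff_map, hlead, map_one])
  refine ⟨E, h1, h2, h3 _ fun n => ?_⟩
  have h := aeval_seqShift_apply hdeg pseudoFactorial n
  rw [aeval_seqShift_reflect_convergentDenom] at h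
  have hd : ((3 ^ ⌈(m : ℚ) / 2⌉₊ * m ! ^ 2 : ℕ) : ℤ) ∣ _ :=
    (natCeil_half m ▸ Dvd.intro _ (prod_jacobiA m).symm).trans
      (dvd_mul_right (∏ j ∈ Finset.range m, jacobiA (j + 1)) (jacobiPath n m))
  rw [h, ← ZMod.intCast_zmod_eq_zero_iff_dvd] at hd
  simpa using hd

theorem corollary9 :
    (∀ M : ℕ, 2 ≤ M → ∃ p : ℕ, 0 < p ∧ ∃ N : ℕ, ∀ n : ℕ, N ≤ n →
      pseudoFactorial (n + p) ≡ pseudoFactorial n [ZMOD M]) ∧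
    (∀ m : ℕ, 2 ≤ m →
      (convergentDenom m).coeff 0 = 1 ∧ (convergentDenom m).natDegree ≤ m ∧
      ∃ E : LinearRecurrence (ZMod (3 ^ ⌈(m : ℚ) / 2⌉₊ * m ! ^ 2)),
        E.order = m ∧
        E.charPoly = ((convergentDenom m).reflect m).map
          (Int.castRingHom (ZMod (3 ^ ⌈(m : ℚ) / 2⌉₊ * m ! ^ 2))) ∧
        E.IsSolution (fun n => (pseudoFactorial n :
          ZMod (3 ^ ⌈(m : ℚ) / 2⌉₊ * m ! ^ 2)))) := by
  refine ⟨fun M hM => ?_, fun m _ => ⟨coeff_zero_convergentDenom m,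
    natDegree_convergentDenom_le m, exists_linearRecurrence_pseudoFactorial m⟩⟩
  obtain ⟨E, -, -, hE⟩ := exists_linearRecurrence_pseudoFactorial M
  -- A nonzero modulus makes the residue ring finite, as the pigeonhole argument requires.
  have : NeZero (3 ^ ⌈(M : ℚ) / 2⌉₊ * M ! ^ 2) := ⟨by positivity⟩
  obtain ⟨p, hp, N, h⟩ := hE.eventually_periodic
  refine ⟨p, hp, N, fun n hn => ?_⟩
  have hdvd : M ∣ 3 ^ ⌈(M : ℚ) / 2⌉₊ * M ! ^ 2 :=
    ((Nat.dvd_factorial (by omega) le_rfl).trans (dvd_pow_self _ two_ne_zero)).mul_left _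
  exact ((ZMod.intCast_eq_intCast_iff _ _ _).1 (h n hn)).of_dvd (Int.natCast_dvd_natCast.2 hdvd)
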